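/- Let $X$ be an infinite-dimensional complex Banach space and let $B(X)$ be the algebra of bounded linear operators on $X$. An operator $S$ on a normed space $Y$ (bounded and linear) is called upper semi-Fredholm if its null space is finite dimensional and its range $S(Y)$ is closed, lower semi-Fredholm if $S(Y)$ has finite codimension in $Y$, and semi-Fredholm if it is upper or lower semi-Fredholm. An operator $S\in B(X)$ is called upper (respectively lower) semi B-Fredholm if for some integer $n\ge 0$ the range $S^n(X)$ is closed and the restriction $S_{[n]}\colon S^n(X)\to S^n(X)$ of $S$ is upper (respectively lower) semi-Fredholm; it is called semi B-Fredholm if it is upper or lower semi B-Fredholm. For $T\in B(X)$ put $$\rho_{sf}(T)=\{\lambda\in\mathbb{C}:\lambda I-T\text{ is semi-Fredholm}\},\qquad \rho_{sbf}(T)=\{\lambda\in\mathbb{C}:\lambda I-T\text{ is semi B-Fredholm}\}.$$ Theorem. For every $T\in B(X)$, the set $\rho_{sbf}(T)$ is connected if and only if the set $\rho_{sf}(T)$ is connected. -/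

import Mathlib

namespace SemiBFredholm

variable {E : Type*} [NormedAddCommGroup E] [NormedSpace ℂ E]

/-- Upper semi-Fredholm: finite-dimensional null space and closed range. -/
def IsUpperSemiFredholm (T : E →L[ℂ] E) : Prop :=
  FiniteDimensional ℂ (LinearMap.ker (T : E →ₗ[ℂ] E)) ∧
    IsClosed (Set.range T)

/-- Lower semi-Fredholm: the range has finite codimension. -/
def IsLowerSemiFredholm (T : E →L[ℂ] E) : Prop :=
  FiniteDimensional ℂ (E ⧸ LinearMap.range (T : E →ₗ[ℂ] E))

/-- Semi-Fredholm: upper or lower semi-Fredholm. -/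
def IsSemiFredholm (T : E →L[ℂ] E) : Prop :=
  IsUpperSemiFredholm T ∨ IsLowerSemiFredholm T

/-- The range of the `n`-th power of `T`, as a subspace. -/
def powRange (T : E →L[ℂ] E) (n : ℕ) : Submodule ℂ E :=
  LinearMap.range ((T ^ n : E →L[ℂ] E) : E →ₗ[ℂ] E)

theorem map_mem_powRange (T : E →L[ℂ] E) (n : ℕ) (x : powRange T n) :
    T (x : E) ∈ powRange T n := by
  obtain ⟨x, y, rfl⟩ := x
  refine ⟨T y, ?_⟩
  change (T ^ n * T) y = (T * T ^ n) y
  rw [← pow_succ, ← pow_succ']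

/-- The restriction of `T` to the range of `T ^ n`, as an operator on that normed space. -/
noncomputable def restrictPow (T : E →L[ℂ] E) (n : ℕ) : powRange T n →L[ℂ] powRange T n :=
  (T.comp (powRange T n).subtypeL).codRestrict (powRange T n) (map_mem_powRange T n)

/-- Upper semi B-Fredholm: for some `n`, the range of `T ^ n` is closed and the restriction of `T`
to it is upper semi-Fredholm. -/
def IsUpperSemiBFredholm (T : E →L[ℂ] E) : Prop :=
  ∃ n : ℕ, IsClosed (powRange T n : Set E) ∧ IsUpperSemiFredholm (restrictPow T n)

/-- Lower semi B-Fredholm: for some `n`, the range of `T ^ n` is closed and the restriction of `T`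
to it is lower semi-Fredholm. -/
def IsLowerSemiBFredholm (T : E →L[ℂ] E) : Prop :=
  ∃ n : ℕ, IsClosed (powRange T n : Set E) ∧ IsLowerSemiFredholm (restrictPow T n)

/-- Semi B-Fredholm: upper or lower semi B-Fredholm. -/
def IsSemiBFredholm (T : E →L[ℂ] E) : Prop :=
  IsUpperSemiBFredholm T ∨ IsLowerSemiBFredholm T

/-- The semi-Fredholm spectrum. -/
def sigmaSF (T : E →L[ℂ] E) : Set ℂ :=
  {z | ¬ IsSemiFredholm (z • ContinuousLinearMap.id ℂ E - T)}

/-- The semi B-Fredholm spectrum. -/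
def sigmaSBF (T : E →L[ℂ] E) : Set ℂ :=
  {z | ¬ IsSemiBFredholm (z • ContinuousLinearMap.id ℂ E - T)}

/-- The semi-Fredholm resolvent set. -/
def rhoSF (T : E →L[ℂ] E) : Set ℂ := (sigmaSF T)ᶜ

/-- The semi B-Fredholm resolvent set. -/
def rhoSBF (T : E →L[ℂ] E) : Set ℂ := (sigmaSBF T)ᶜ

end SemiBFredholm

open Filter Topology

/-! Semi-Fredholm is the case n = 0 of semi B-Fredholm, so ρ_sf ⊆ ρ_sbf. Conversely, every point of
ρ_sbf has a punctured neighbourhood in ρ_sf. Indeed, if S is semi B-Fredholm with exponent n, then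
S_[n] + z is semi-Fredholm for small z, by openness on the Banach space S^n(X). For z ≠ 0, S + z
divides S^n - (-z)^n, so S^n acts as a nonzero scalar modulo S + z, and the property passes from
S_[n] + z to S + z. The rest is plane topology: removing such isolated points keeps ρ_sbf connected,
while ρ_sbf lies between ρ_sf and its closure. -/

/-- A punctured ball in a real normed space of dimension greater than one is preconnected. -/
theorem isPreconnected_ball_diff_singleton {E : Type*} [NormedAddCommGroup E] [NormedSpace ℝ E]
    (h : 1 < Module.rank ℝ E) (x : E) (r : ℝ) : IsPreconnected (Metric.ball x r \ {x}) := by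
  -- Polar coordinates: a continuous image of sphere times interval.
  have himage : (fun p : E × ℝ => x + p.2 • p.1) '' (Metric.sphere 0 1 ×ˢ Set.Ioo 0 r) =
      Metric.ball x r \ {x} := by
    ext y
    constructor
    · rintro ⟨⟨v, t⟩, ⟨hv, ht0, htr⟩, rfl⟩
      have hv1 : ‖v‖ = 1 := by simpa using hv
      have hv0 : v ≠ 0 := by
        rintro rfl
        simp at hv1
      refine ⟨?_, ?_⟩
      · simpa [norm_smul, hv1, abs_of_pos ht0] using htr
      · simp [hv0, ht0.ne']
    · rintro ⟨hy, hyx⟩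
      have hne : ‖y - x‖ ≠ 0 := by
        rw [norm_ne_zero_iff, sub_ne_zero]
        exact hyx
      refine ⟨(‖y - x‖⁻¹ • (y - x), ‖y - x‖), ⟨?_, ?_, ?_⟩, ?_⟩
      · simp [norm_smul, hne]
      · exact (norm_nonneg _).lt_of_ne hne.symm
      · simpa [dist_eq_norm] using hy
      · simp [smul_smul, hne]
  rw [← himage]
  exact ((isPreconnected_sphere h 0 1).prod isPreconnected_Ioo).image _ (by fun_prop)

/-- Removing isolated points from a preconnected set that is a neighbourhood of each of its points
leaves it preconnected, in dimension greater than one. -/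
theorem IsPreconnected.of_eventually_punctured_nhds {E : Type*} [NormedAddCommGroup E]
    [NormedSpace ℝ E] (h : 1 < Module.rank ℝ E) {U V : Set E} (hU : IsPreconnected U)
    (hVU : V ⊆ U) (hV : ∀ x ∈ U, ∀ᶠ y in 𝓝[≠] x, y ∈ V) : IsPreconnected V := by
  have : Nontrivial E := (rank_pos_iff_nontrivial (R := ℝ)).1 (zero_lt_one.trans h)
  have hopen : ∀ A : Set E, IsOpen {x | ∀ᶠ y in 𝓝[≠] x, y ∈ A} := by
    intro A
    refine isOpen_iff_mem_nhds.2 fun x hx => ?_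
    obtain ⟨W, hW, hWo, hxW⟩ := eventually_nhds_iff.1 (eventually_nhdsWithin_iff.1 hx)
    filter_upwards [hWo.mem_nhds hxW] with y hy
    rcases eq_or_ne y x with rfl | hyx
    · exact hx
    · refine eventually_nhdsWithin_of_eventually_nhds ?_
      filter_upwards [hWo.mem_nhds hy, isOpen_ne.mem_nhds hyx] with z hz hzx using hW z hz hzx
  rw [isPreconnected_iff_subset_of_disjoint] at hU ⊢
  intro A B hA hB hAB hdisj
  -- A small punctured ball is connected, so one of `A`, `B` contains it: a separation of `V`
  -- extends over the missing points of `U`.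
  have hcover : U ⊆ {x | ∀ᶠ y in 𝓝[≠] x, y ∈ V ∩ A} ∪ {x | ∀ᶠ y in 𝓝[≠] x, y ∈ V ∩ B} := by
    intro x hx
    obtain ⟨r, hr, hball⟩ := Metric.mem_nhdsWithin_iff.1 (hV x hx)
    have hmem : Metric.ball x r \ {x} ∈ 𝓝[≠] x :=
      Metric.mem_nhdsWithin_iff.2 ⟨r, hr, subset_rfl⟩
    have hdisj' : Metric.ball x r \ {x} ∩ (A ∩ B) = ∅ :=
      Set.subset_eq_empty (Set.inter_subset_inter_left _ hball) hdisj
    exact (isPreconnected_iff_subset_of_disjoint.1 (isPreconnected_ball_diff_singleton h x r) A B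
      hA hB (hball.trans hAB) hdisj').imp
        (fun hs => mem_of_superset hmem (Set.subset_inter hball hs))
        (fun hs => mem_of_superset hmem (Set.subset_inter hball hs))
  have key : ∀ A' B' : Set E, IsOpen B' → V ∩ (A' ∩ B') = ∅ →
      U ⊆ {x | ∀ᶠ y in 𝓝[≠] x, y ∈ V ∩ A'} → V ⊆ A' ∪ B' → V ⊆ A' := by
    intro A' B' hB' hd hsub hV' x hx
    refine (hV' hx).resolve_right fun hxB => ?_
    have h1 : ∀ᶠ y in 𝓝[≠] x, y ∈ V ∩ A' := hsub (hVU hx)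
    have h2 : ∀ᶠ y in 𝓝[≠] x, y ∈ B' :=
      eventually_nhdsWithin_of_eventually_nhds (hB'.mem_nhds hxB)
    have : (𝓝[≠] x).NeBot := Module.punctured_nhds_neBot ℝ E x
    obtain ⟨y, hy1, hy2⟩ := (h1.and h2).exists
    exact Set.eq_empty_iff_forall_notMem.1 hd y ⟨hy1.1, hy1.2, hy2⟩
  have hdisj' : U ∩ ({x | ∀ᶠ y in 𝓝[≠] x, y ∈ V ∩ A} ∩ {x | ∀ᶠ y in 𝓝[≠] x, y ∈ V ∩ B}) = ∅ := by
    refine Set.eq_empty_iff_forall_notMem.2 fun x hx => ?_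
    have : (𝓝[≠] x).NeBot := Module.punctured_nhds_neBot ℝ E x
    obtain ⟨y, hy1, hy2⟩ := (Filter.Eventually.and (Set.mem_ofPred.1 hx.2.1) (Set.mem_ofPred.1 hx.2.2)).exists
    exact Set.eq_empty_iff_forall_notMem.1 hdisj y ⟨hy1.1, hy1.2, hy2.2⟩
  refine (hU _ _ (hopen _) (hopen _) hcover hdisj').imp (fun hs => key A B hB hdisj hs hAB)
    fun hs => key B A hA ?_ hs ?_
  · rwa [Set.inter_comm B A]
  · rwa [Set.union_comm B A]

/-! ### Stability of surjectivity and of lower bounds -/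

namespace ContinuousLinearMap

variable {E F : Type*} [NormedAddCommGroup E] [NormedSpace ℂ E] [NormedAddCommGroup F]
  [NormedSpace ℂ F]

/-- Surjectivity is an open condition on bounded operators between Banach spaces. -/
theorem eventually_surjective [CompleteSpace E] [CompleteSpace F] {f : E →L[ℂ] F}
    (hf : Function.Surjective f) : ∀ᶠ g : E →L[ℂ] F in 𝓝 f, Function.Surjective g := by
  have hrange : f.range = ⊤ := LinearMap.range_eq_top.2 hf
  have hpos : 0 < (f.nonlinearRightInverseOfSurjective hrange).nnnorm :=
    f.nonlinearRightInverseOfSurjective_nnnorm_pos hrange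
  have hev : ∀ᶠ g in 𝓝 f,
      ‖g - f‖₊ < (f.nonlinearRightInverseOfSurjective hrange).nnnorm⁻¹ := by
    have hcont : Continuous fun g : E →L[ℂ] F => ‖g - f‖₊ := by fun_prop
    refine hcont.continuousAt.eventually (gt_mem_nhds ?_)
    simpa using hpos
  filter_upwards [hev] with g hg
  have happrox : ApproximatesLinearOn g f Set.univ ‖g - f‖₊ := by
    intro x _ y _
    have := (g - f).le_opNorm (x - y)
    simpa [sub_apply, map_sub, sub_sub_sub_comm] using this
  have hnhds := happrox.image_mem_nhds (x := 0) (f.nonlinearRightInverseOfSurjective hrange)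
    univ_mem (Or.inr hg)
  rw [Set.image_univ] at hnhds
  -- A subspace with nonempty interior is the whole space.
  have htop : g.range = ⊤ := by
    refine Submodule.eq_top_of_nonempty_interior' _ ⟨g 0, ?_⟩
    exact mem_interior_iff_mem_nhds.2 hnhds
  exact LinearMap.range_eq_top.1 htop

/-- Being bounded below is an open condition on bounded operators. -/
theorem eventually_antilipschitzWith {f : E →L[ℂ] F} (hf : ∃ K, AntilipschitzWith K f) :
    ∀ᶠ g : E →L[ℂ] F in 𝓝 f, ∃ K, AntilipschitzWith K g := by
  obtain ⟨K, hK⟩ := hf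
  -- `K` may be `0`, whose inverse is `0`; `K + 1` gives a positive radius.
  have hK1 : AntilipschitzWith (K + 1) f := fun x y =>
    (hK x y).trans (by gcongr; simp)
  have hev : ∀ᶠ g in 𝓝 f, ‖g - f‖₊ < (K + 1)⁻¹ := by
    have hcont : Continuous fun g : E →L[ℂ] F => ‖g - f‖₊ := by fun_prop
    refine hcont.continuousAt.eventually (gt_mem_nhds ?_)
    simp
  filter_upwards [hev] with g hg
  exact ⟨_, hK1.add_sub_lipschitzWith (g - f).lipschitz hg⟩

end ContinuousLinearMap

namespace SemiBFredholm

/-! ### Openness of the semi-Fredholm classes -/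

section Open

variable {E : Type*} [NormedAddCommGroup E] [NormedSpace ℂ E] [CompleteSpace E]

/-- `A` is bounded below on a closed complement `W` of its kernel, hence so is every nearby `B`.
Then ker `B` meets `W` trivially and embeds in the finite-dimensional `E ⧸ W`, and `B(W)` is closed,
which forces the range of `B` to be closed. -/
theorem IsUpperSemiFredholm.eventually {A : E →L[ℂ] E} (hA : IsUpperSemiFredholm A) :
    ∀ᶠ B in 𝓝 A, IsUpperSemiFredholm B := by
  obtain ⟨hker, hrange⟩ := hA
  obtain ⟨W, hWc, hcompl⟩ :=
    (Submodule.ClosedComplemented.of_finiteDimensional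
      (LinearMap.ker (A : E →ₗ[ℂ] E))).exists_isClosed_isCompl
  have : CompleteSpace W := hWc.completeSpace_coe
  have hfin : FiniteDimensional ℂ (E ⧸ W) :=
    (Submodule.quotientEquivOfIsCompl _ _ hcompl.symm).symm.finiteDimensional
  have hinj : Function.Injective (A.comp W.subtypeL) := by
    refine (injective_iff_map_eq_zero _).2 fun x hx => ?_
    exact Subtype.ext ((Submodule.disjoint_def.1 hcompl.disjoint) x hx x.2)
  have hrangeW : Set.range (A.comp W.subtypeL) = Set.range A := by
    refine subset_antisymm ?_ ?_
    · rintro _ ⟨x, rfl⟩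
      exact ⟨x, rfl⟩
    · rintro _ ⟨x, rfl⟩
      obtain ⟨y, hy, w, hw, rfl⟩ :=
        Submodule.mem_sup.1 (hcompl.sup_eq_top ▸ Submodule.mem_top : x ∈ _ ⊔ W)
      have hy0 : A y = 0 := hy
      exact ⟨⟨w, hw⟩, by simp [hy0]⟩
  have hanti := ContinuousLinearMap.antilipschitz_of_injective_of_isClosed_range
    (A.comp W.subtypeL) hinj (hrangeW ▸ hrange)
  have hcont : Continuous fun B : E →L[ℂ] E => B.comp W.subtypeL := by fun_prop
  filter_upwards [hcont.continuousAt.eventually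
    (ContinuousLinearMap.eventually_antilipschitzWith hanti)] with B hB
  obtain ⟨K, hK⟩ := hB
  constructor
  · refine FiniteDimensional.of_injective
      (W.mkQ.comp (LinearMap.ker (B : E →ₗ[ℂ] E)).subtype) ?_
    refine (injective_iff_map_eq_zero _).2 fun x hx => ?_
    have hxW : (x : E) ∈ W := by simpa using hx
    have hBx : B x = 0 := x.2
    have : (⟨x, hxW⟩ : W) = 0 := hK.injective (by simp [hBx])
    exact Subtype.ext (congrArg (Subtype.val : W → E) this)
  · have hclosed : IsClosed ((W.map (B : E →ₗ[ℂ] E) : Submodule ℂ E) : Set E) := by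
      have h1 := hK.isClosed_range (B.comp W.subtypeL).uniformContinuous
      have h2 : ((W.map (B : E →ₗ[ℂ] E) : Submodule ℂ E) : Set E) =
          Set.range (B.comp W.subtypeL) := by
        ext y
        simp
      rwa [h2]
    have : W.CoFG := hfin
    exact LinearMap.isClosed_range_of_isClosed_map_of_finiteDimensional_quotient hclosed

/-- Adding the inclusion of a finite-dimensional complement `F` of the range makes `A` a surjection
from `E × F`. This persists for nearby `B`, and then `F` maps onto the cokernel of `B`. -/
theorem IsLowerSemiFredholm.eventually {A : E →L[ℂ] E} (hA : IsLowerSemiFredholm A) :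
    ∀ᶠ B in 𝓝 A, IsLowerSemiFredholm B := by
  obtain ⟨F, hF⟩ := Submodule.exists_isCompl (LinearMap.range (A : E →ₗ[ℂ] E))
  have hA' : FiniteDimensional ℂ (E ⧸ LinearMap.range (A : E →ₗ[ℂ] E)) := hA
  have hFfin : FiniteDimensional ℂ F :=
    (Submodule.quotientEquivOfIsCompl _ _ hF).finiteDimensional
  have : CompleteSpace F := FiniteDimensional.complete ℂ F
  have hsurj : Function.Surjective (A.coprod F.subtypeL) := by
    intro y
    obtain ⟨_, ⟨x, rfl⟩, w, hw, rfl⟩ :=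
      Submodule.mem_sup.1 (hF.sup_eq_top ▸ Submodule.mem_top : y ∈ _ ⊔ F)
    exact ⟨(x, ⟨w, hw⟩), by simp⟩
  have hcont : Continuous fun B : E →L[ℂ] E => B.coprod F.subtypeL := by
    have : (fun B : E →L[ℂ] E => B.coprod F.subtypeL) = fun B =>
        B.comp (ContinuousLinearMap.fst ℂ E F) +
          F.subtypeL.comp (ContinuousLinearMap.snd ℂ E F) := by
      ext B x <;> simp
    rw [this]
    fun_prop
  filter_upwards [hcont.continuousAt.eventually
    (ContinuousLinearMap.eventually_surjective hsurj)] with B hB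
  refine Module.Finite.of_surjective
    ((LinearMap.range (B : E →ₗ[ℂ] E)).mkQ.comp F.subtype) fun q => ?_
  obtain ⟨y, rfl⟩ := Submodule.mkQ_surjective _ q
  obtain ⟨⟨x, w⟩, rfl⟩ := hB y
  refine ⟨w, ?_⟩
  simp

end Open

/-! ### Passing from the restriction on S^n(X) to S -/

section Reduction

variable {E : Type*} [NormedAddCommGroup E] [NormedSpace ℂ E]

/-- For `z ≠ 0`, the operator `S + z` divides `S ^ n - (-z) ^ n`, by an operator commuting with
it. -/
theorem exists_add_smul_apply_eq (S : E →L[ℂ] E) (n : ℕ) {z : ℂ} (hz : z ≠ 0) :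
    ∃ (Q : E →L[ℂ] E) (c : ℂ), c ≠ 0 ∧
      (∀ x, Q ((S + z • ContinuousLinearMap.id ℂ E) x) = (S ^ n) x - c • x) ∧
      ∀ x, (S + z • ContinuousLinearMap.id ℂ E) (Q x) = (S ^ n) x - c • x := by
  have hcomm : Commute S (algebraMap ℂ (E →L[ℂ] E) (-z)) := Algebra.commute_algebraMap_right _ _
  have hsub : S - algebraMap ℂ (E →L[ℂ] E) (-z) = S + z • ContinuousLinearMap.id ℂ E := by
    rw [map_neg, sub_neg_eq_add, Algebra.algebraMap_eq_smul_one]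
    rfl
  have hpow : ∀ x, (S ^ n - algebraMap ℂ (E →L[ℂ] E) (-z) ^ n) x = (S ^ n) x - (-z) ^ n • x := by
    intro x
    rw [← map_pow, Algebra.algebraMap_eq_smul_one]
    rfl
  refine ⟨∑ i ∈ Finset.range n, S ^ i * algebraMap ℂ (E →L[ℂ] E) (-z) ^ (n - 1 - i), (-z) ^ n,
    pow_ne_zero _ (neg_ne_zero.2 hz), fun x => ?_, fun x => ?_⟩
  · rw [← hpow, ← hcomm.geom_sum₂_mul n, hsub]
    rfl
  · rw [← hpow, ← hcomm.mul_geom_sum₂ n, hsub]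
    rfl

theorem mem_powRange_of_add_smul_apply_eq_zero (S : E →L[ℂ] E) (n : ℕ) {z : ℂ} (hz : z ≠ 0) {x : E}
    (hx : (S + z • ContinuousLinearMap.id ℂ E) x = 0) : x ∈ powRange S n := by
  obtain ⟨Q, c, hc, hQ, -⟩ := exists_add_smul_apply_eq S n hz
  have h := hQ x
  rw [hx, map_zero, eq_comm, sub_eq_zero] at h
  refine ⟨c⁻¹ • x, ?_⟩
  change (S ^ n) (c⁻¹ • x) = x
  rw [map_smul, h, smul_smul, inv_mul_cancel₀ hc, one_smul]

/-- One direction is that S^n commutes with S + z. For the other, (S + z)m = S^n y and (S + z)Qy =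
S^n y - cy give (S + z)(m - Qy) = cy. Thus S^n induces an injection of cokernels. -/
theorem mem_range_add_smul_iff (S : E →L[ℂ] E) (n : ℕ) {z : ℂ} (hz : z ≠ 0) (y : E) :
    y ∈ LinearMap.range ((S + z • ContinuousLinearMap.id ℂ E : E →L[ℂ] E) : E →ₗ[ℂ] E) ↔
      (⟨(S ^ n) y, y, rfl⟩ : powRange S n) ∈ LinearMap.range ((restrictPow S n +
        z • ContinuousLinearMap.id ℂ (powRange S n) : powRange S n →L[ℂ] powRange S n) :
          powRange S n →ₗ[ℂ] powRange S n) := by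
  constructor
  · rintro ⟨x, rfl⟩
    refine ⟨⟨(S ^ n) x, x, rfl⟩, Subtype.ext ?_⟩
    change S ((S ^ n) x) + z • (S ^ n) x = (S ^ n) (S x + z • x)
    rw [map_add, map_smul]
    congr 1
    change (S * S ^ n) x = (S ^ n * S) x
    rw [← pow_succ, ← pow_succ']
  · rintro ⟨m, hm⟩
    obtain ⟨Q, c, hc, -, hQ⟩ := exists_add_smul_apply_eq S n hz
    have hm' : (S + z • ContinuousLinearMap.id ℂ E) m = (S ^ n) y := congrArg Subtype.val hm
    refine ⟨c⁻¹ • ((m : E) - Q y), ?_⟩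
    change (S + z • ContinuousLinearMap.id ℂ E) (c⁻¹ • ((m : E) - Q y)) = y
    rw [map_smul, map_sub, hm', hQ, sub_sub_cancel, smul_smul, inv_mul_cancel₀ hc, one_smul]

theorem IsUpperSemiFredholm.of_restrictPow {S : E →L[ℂ] E} {n : ℕ}
    {z : ℂ} (hz : z ≠ 0)
    (h : IsUpperSemiFredholm (restrictPow S n + z • ContinuousLinearMap.id ℂ (powRange S n))) :
    IsUpperSemiFredholm (S + z • ContinuousLinearMap.id ℂ E) := by
  obtain ⟨hker, hrange⟩ := h
  constructor
  · refine FiniteDimensional.of_injective (LinearMap.codRestrict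
      (LinearMap.ker ((restrictPow S n + z • ContinuousLinearMap.id ℂ (powRange S n) :
        powRange S n →L[ℂ] powRange S n) : powRange S n →ₗ[ℂ] powRange S n))
      (LinearMap.codRestrict (powRange S n) (Submodule.subtype _)
        fun x => mem_powRange_of_add_smul_apply_eq_zero S n hz x.2)
      fun x => Subtype.ext x.2) ?_
    intro x y hxy
    exact Subtype.ext (congrArg (fun w => ((w.1 : powRange S n) : E)) hxy)
  · have hpre : Set.range (S + z • ContinuousLinearMap.id ℂ E) =
        (fun y => (⟨(S ^ n) y, y, rfl⟩ : powRange S n)) ⁻¹'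
          Set.range (restrictPow S n + z • ContinuousLinearMap.id ℂ (powRange S n)) :=
      Set.ext (mem_range_add_smul_iff S n hz)
    rw [hpre]
    exact hrange.preimage ((S ^ n).continuous.subtype_mk _)

theorem IsLowerSemiFredholm.of_restrictPow {S : E →L[ℂ] E} {n : ℕ} {z : ℂ} (hz : z ≠ 0)
    (h : IsLowerSemiFredholm (restrictPow S n + z • ContinuousLinearMap.id ℂ (powRange S n))) :
    IsLowerSemiFredholm (S + z • ContinuousLinearMap.id ℂ E) := by
  have h' : FiniteDimensional ℂ (powRange S n ⧸ LinearMap.range ((restrictPow S n +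
    z • ContinuousLinearMap.id ℂ (powRange S n) : powRange S n →L[ℂ] powRange S n) :
      powRange S n →ₗ[ℂ] powRange S n)) := h
  let φ := (LinearMap.range ((restrictPow S n +
    z • ContinuousLinearMap.id ℂ (powRange S n) : powRange S n →L[ℂ] powRange S n) :
      powRange S n →ₗ[ℂ] powRange S n)).mkQ.comp
    (LinearMap.rangeRestrict ((S ^ n : E →L[ℂ] E) : E →ₗ[ℂ] E))
  have hker : LinearMap.ker φ =
      LinearMap.range ((S + z • ContinuousLinearMap.id ℂ E : E →L[ℂ] E) : E →ₗ[ℂ] E) := by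
    ext y
    rw [mem_range_add_smul_iff S n hz]
    exact Submodule.Quotient.mk_eq_zero _
  unfold IsLowerSemiFredholm
  rw [← hker]
  exact φ.quotKerEquivRange.symm.finiteDimensional

theorem IsSemiFredholm.isSemiBFredholm {S : E →L[ℂ] E} (h : IsSemiFredholm S) :
    IsSemiBFredholm S := by
  -- Take n = 0: S^0(E) is all of `E`, though as a subtype, so kernel and range must be transported.
  have htop : ∀ x, x ∈ powRange S 0 := fun x => ⟨x, rfl⟩
  have hclosed : IsClosed (powRange S 0 : Set E) := by
    rw [Set.eq_univ_of_forall (s := (powRange S 0 : Set E)) htop]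
    exact isClosed_univ
  rcases h with ⟨hker, hrange⟩ | h
  · refine Or.inl ⟨0, hclosed, ?_, ?_⟩
    · refine FiniteDimensional.of_injective (LinearMap.codRestrict
        (LinearMap.ker (S : E →ₗ[ℂ] E)) ((powRange S 0).subtype.comp (Submodule.subtype _))
        fun x => congrArg Subtype.val x.2) ?_
      intro x y hxy
      exact Subtype.ext (Subtype.ext (congrArg Subtype.val hxy :))
    · have hpre : Set.range (restrictPow S 0) = Subtype.val ⁻¹' Set.range S := by
        ext y
        constructor
        · rintro ⟨x, rfl⟩
          exact ⟨x, rfl⟩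
        · rintro ⟨x, hx⟩
          exact ⟨⟨x, htop x⟩, Subtype.ext hx⟩
      rw [hpre]
      exact hrange.preimage continuous_subtype_val
  · refine Or.inr ⟨0, hclosed, ?_⟩
    have h' : FiniteDimensional ℂ (E ⧸ LinearMap.range (S : E →ₗ[ℂ] E)) := h
    refine Module.Finite.of_surjective ((LinearMap.range (S : E →ₗ[ℂ] E)).liftQ
      ((LinearMap.range (restrictPow S 0 : powRange S 0 →ₗ[ℂ] powRange S 0)).mkQ.comp
        (LinearMap.codRestrict (powRange S 0) LinearMap.id htop)) ?_) ?_
    · rintro _ ⟨x, rfl⟩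
      exact (Submodule.Quotient.mk_eq_zero _).2 ⟨⟨x, htop x⟩, rfl⟩
    · intro q
      obtain ⟨y, rfl⟩ := Submodule.mkQ_surjective _ q
      exact ⟨Submodule.Quotient.mk y, rfl⟩

/-- All small nonzero scalar perturbations of a semi B-Fredholm operator are semi-Fredholm. -/
theorem IsSemiBFredholm.eventually_isSemiFredholm [CompleteSpace E] {S : E →L[ℂ] E}
    (h : IsSemiBFredholm S) :
    ∀ᶠ z in 𝓝[≠] (0 : ℂ), IsSemiFredholm (S + z • ContinuousLinearMap.id ℂ E) := by
  have htendsto : ∀ n, Tendsto (fun z : ℂ => restrictPow S n + z • ContinuousLinearMap.id ℂ (powRange S n))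
      (𝓝[≠] 0) (𝓝 (restrictPow S n)) := by
    intro n
    have hcont : Continuous fun z : ℂ => restrictPow S n + z • ContinuousLinearMap.id ℂ (powRange S n) := by
      fun_prop
    have hzero : restrictPow S n + (0 : ℂ) • ContinuousLinearMap.id ℂ (powRange S n) =
        restrictPow S n := by
      ext x
      change S x + (0 : ℂ) • (x : E) = S x
      rw [zero_smul, add_zero]
    have h0 := (hcont.tendsto 0).mono_left (nhdsWithin_le_nhds (s := {0}ᶜ))
    rwa [hzero] at h0
  rcases h with ⟨n, hn, h⟩ | ⟨n, hn, h⟩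
  -- Closedness of S^n(E) is used here: the openness results need a Banach space.
  · have : CompleteSpace (powRange S n) := hn.completeSpace_coe
    filter_upwards [(htendsto n).eventually h.eventually, self_mem_nhdsWithin] with z hz hz0
    exact Or.inl (.of_restrictPow hz0 hz)
  · have : CompleteSpace (powRange S n) := hn.completeSpace_coe
    filter_upwards [(htendsto n).eventually h.eventually, self_mem_nhdsWithin] with z hz hz0
    exact Or.inr (.of_restrictPow hz0 hz)

end Reduction

/-! ### Comparison of the two resolvent sets -/

section Resolvent

variable {E : Type*} [NormedAddCommGroup E] [NormedSpace ℂ E]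

theorem mem_rhoSF {T : E →L[ℂ] E} {z : ℂ} :
    z ∈ rhoSF T ↔ IsSemiFredholm (z • ContinuousLinearMap.id ℂ E - T) := not_not

theorem mem_rhoSBF {T : E →L[ℂ] E} {z : ℂ} :
    z ∈ rhoSBF T ↔ IsSemiBFredholm (z • ContinuousLinearMap.id ℂ E - T) := not_not

theorem rhoSF_subset_rhoSBF (T : E →L[ℂ] E) : rhoSF T ⊆ rhoSBF T := fun _ hz =>
  mem_rhoSBF.2 (mem_rhoSF.1 hz).isSemiBFredholm

theorem eventually_mem_rhoSF [CompleteSpace E] {T : E →L[ℂ] E} {z : ℂ} (hz : z ∈ rhoSBF T) :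
    ∀ᶠ w in 𝓝[≠] z, w ∈ rhoSF T := by
  have h := (mem_rhoSBF.1 hz).eventually_isSemiFredholm
  -- wI - T is the perturbation of zI - T by the scalar w - z.
  have htendsto : Tendsto (fun w : ℂ => w - z) (𝓝[≠] z) (𝓝[≠] 0) := by
    refine tendsto_nhdsWithin_iff.2 ⟨?_, ?_⟩
    · have hcont : Continuous fun w : ℂ => w - z := by fun_prop
      simpa using (hcont.tendsto z).mono_left nhdsWithin_le_nhds
    · filter_upwards [self_mem_nhdsWithin] with w hw
      exact sub_ne_zero.2 hw
  filter_upwards [htendsto.eventually h] with w hw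
  rw [mem_rhoSF]
  convert! hw using 1
  module

end Resolvent

end SemiBFredholm

theorem mainTheorem9 {X : Type*} [NormedAddCommGroup X] [NormedSpace ℂ X] [CompleteSpace X]
    (hX : ¬ FiniteDimensional ℂ X) (T : X →L[ℂ] X) :
    IsConnected (SemiBFredholm.rhoSBF T) ↔ IsConnected (SemiBFredholm.rhoSF T) := by
  constructor
  · rintro ⟨⟨z, hz⟩, hconn⟩
    refine ⟨(SemiBFredholm.eventually_mem_rhoSF hz).exists, ?_⟩
    exact hconn.of_eventually_punctured_nhds (by simp)
      (SemiBFredholm.rhoSF_subset_rhoSBF T) fun _ => SemiBFredholm.eventually_mem_rhoSF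
  · intro h
    refine h.subset_closure (SemiBFredholm.rhoSF_subset_rhoSBF T) fun z hz => ?_
    refine mem_closure_iff_frequently.2 ?_
    exact (SemiBFredholm.eventually_mem_rhoSF hz).frequently.filter_mono nhdsWithin_le_nhds
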